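/- Let $\beta>1$ be a hyperbolic real number, that is, an algebraic integer which is a root of a nonzero polynomial with all coefficients in $\{-1,0,1\}$ and which has no Galois conjugate of absolute value one. Let \[ X(\beta)=\Big\{\sum_{i=1}^n c_i\beta^{n-i} : n\in\mathbb N,\ c_1,\dots,c_n\in\{-1,0,1\}\Big\} \] be its spectrum, and for $n\in\mathbb N$ and $x\in\mathbb R$ let \[ \mathcal N_n(x)=\#\Big\{(a_1\cdots a_n,\,b_1\cdots b_n)\in\{0,1\}^n\times\{0,1\}^n : \sum_{i=1}^n (a_i-b_i)\beta^{n-i}=x\Big\}. \] Then there exists a real number $\lambda$ with $1<\lambda<4$ such that for every $x\in X(\beta)$ the limit \[ \mu(x):=\lim_{n\to\infty}\frac{1}{\lambda^n}\mathcal N_n(x) \] exists and lies in $(0,\infty)$. Furthermore, the resulting measure $\mu$ on $X(\beta)$, which gives mass $\mu(x)$ to each point $x\in X(\beta)$, has infinite total mass. -/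

import Mathlib

open Polynomial Filter Topology MeasureTheory

/-- A real number `β` is hyperbolic if it is an algebraic integer, a root of a nonzero polynomial
all of whose coefficients lie in `{-1, 0, 1}`, and no Galois conjugate of `β` (complex root of the
minimal polynomial of `β` over `ℚ`) has absolute value one. -/
structure IsHyperbolic (β : ℝ) : Prop where
  isIntegral : IsIntegral ℤ β
  exists_poly : ∃ p : ℤ[X], p ≠ 0 ∧ (∀ k, p.coeff k ∈ ({-1, 0, 1} : Set ℤ)) ∧ aeval β p = 0
  conj_ne_one : ∀ z : ℂ, aeval z (minpoly ℚ β) = 0 → ‖z‖ ≠ 1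

/-- The value `∑_{i=1}^n c_i β^{n-i}`; the letter `c_{i+1}` of the word is `c i`. -/
noncomputable def wordValue (β : ℝ) {n : ℕ} (c : Fin n → ℤ) : ℝ :=
  ∑ i : Fin n, (c i : ℝ) * β ^ (n - ((i : ℕ) + 1))

/-- The spectrum `X(β)` over the alphabet `{-1, 0, 1}`. -/
def betaSpectrum (β : ℝ) : Set ℝ :=
  {x | ∃ (n : ℕ) (c : Fin n → ℤ), (∀ i, c i ∈ ({-1, 0, 1} : Set ℤ)) ∧ wordValue β c = x}

/-- `𝒩_n(x)`: the number of pairs of words `a, b ∈ {0,1}^n` with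
`∑_{i=1}^n (a_i - b_i) β^{n-i} = x`. -/
noncomputable def pairCount (β : ℝ) (n : ℕ) (x : ℝ) : ℕ :=
  Nat.card {p : (Fin n → Fin 2) × (Fin n → Fin 2) //
    wordValue β (fun i => (((p.1 i : Fin 2) : ℕ) : ℤ) - (((p.2 i : Fin 2) : ℕ) : ℤ)) = x}

/-! Appending digits gives `𝒩_{n+1}(x) = 𝒩_n((x-1)/β) + 2𝒩_n(x/β) + 𝒩_n((x+1)/β)`. Hyperbolicity
places each point of the spectrum in a finite set `S` that contains 0 and its own predecessors
(`exists_isBackwardClosed`), so on `S` the recursion is a finite nonnegative matrix. A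
Perron–Frobenius argument follows: 0 reaches all of `S` in `k` steps and `𝒩_n` is maximal at 0, so
the range of the ratios `𝒩_{n+1}/𝒩_n` over `S` shrinks geometrically (`ratioBound_contract`). The
ratios tend to some `λ ≥ 2`, and summable errors make `𝒩_n(x)/λ^n` converge to a positive limit. The
limit is an eigenfunction of the recursion. Summing it over `S` loses mass at the maximum of `S`, so
`λ < 4`; summing over all of `ℝ` gives `λT = 4T` with `T > 0`, so `T = ∞`. -/

/-! ### Words and the spectrum -/

theorem wordValue_succ (β : ℝ) {n : ℕ} (c : Fin (n + 1) → ℤ) :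
    wordValue β c = β * wordValue β (fun i : Fin n => c i.castSucc) + c (Fin.last n) := by
  unfold wordValue
  rw [Fin.sum_univ_castSucc, Finset.mul_sum]
  congr 1
  · refine Finset.sum_congr rfl fun i _ => ?_
    have h : n + 1 - ((i.castSucc : ℕ) + 1) = (n - ((i : ℕ) + 1)) + 1 := by
      have := i.2
      simp only [Fin.val_castSucc]
      omega
    rw [h, pow_succ]
    ring
  · simp

theorem wordValue_sub (β : ℝ) {n : ℕ} (a b : Fin n → ℤ) :
    wordValue β (fun i => a i - b i) = wordValue β a - wordValue β b := by
  simp [wordValue, sub_mul, Finset.sum_sub_distrib]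

theorem zero_mem_betaSpectrum (β : ℝ) : (0 : ℝ) ∈ betaSpectrum β :=
  ⟨0, fun _ => 0, by simp, by simp [wordValue]⟩

theorem mul_add_mem_betaSpectrum {β y : ℝ} (hy : y ∈ betaSpectrum β) {c : ℤ}
    (hc : c ∈ ({-1, 0, 1} : Set ℤ)) : β * y + c ∈ betaSpectrum β := by
  obtain ⟨n, w, hw, rfl⟩ := hy
  refine ⟨n + 1, Fin.snoc (α := fun _ => ℤ) w c, fun i => ?_, ?_⟩
  · refine Fin.lastCases ?_ (fun j => ?_) i
    · simpa using hc
    · simpa using hw j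
  · rw [wordValue_succ]
    simp

theorem betaSpectrum_induction {β : ℝ} {p : ℝ → Prop} (zero : p 0)
    (step : ∀ y, p y → ∀ c ∈ ({-1, 0, 1} : Set ℤ), p (β * y + c)) :
    ∀ x ∈ betaSpectrum β, p x := by
  rintro x ⟨n, w, hw, rfl⟩
  induction n with
  | zero => simpa [wordValue] using zero
  | succ n ih =>
    rw [wordValue_succ]
    exact step _ (ih _ fun i => hw _) _ (hw _)

theorem countable_betaSpectrum (β : ℝ) : (betaSpectrum β).Countable := by
  refine (Set.countable_iUnion fun n : ℕ =>
    Set.countable_range (fun c : Fin n → ℤ => wordValue β c)).mono ?_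
  rintro x ⟨n, c, -, rfl⟩
  exact Set.mem_iUnion.2 ⟨n, c, rfl⟩

/-! ### Finiteness from hyperbolicity -/

/-- Finitely many points of the spectrum, stable under passing to a predecessor in the spectrum. -/
structure IsBackwardClosed (β : ℝ) (S : Finset ℝ) : Prop where
  zero_mem : 0 ∈ S
  subset : ∀ y ∈ S, y ∈ betaSpectrum β
  pred_mem : ∀ y ∈ betaSpectrum β, ∀ c ∈ ({-1, 0, 1} : Set ℤ), β * y + c ∈ S → y ∈ S

theorem norm_intCast_le_one_of_mem {c : ℤ} (hc : c ∈ ({-1, 0, 1} : Set ℤ)) : ‖(c : ℂ)‖ ≤ 1 := by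
  simp only [Set.mem_insert_iff, Set.mem_singleton_iff] at hc
  rcases hc with rfl | rfl | rfl <;> simp

/-- Algebraic integers of `ℚ(β)` with all conjugates bounded by `B` are finite in number. Where the
conjugate of `β` is inside the unit circle, the whole spectrum is bounded; where it is outside,
passing to a predecessor contracts. -/
theorem exists_isBackwardClosed {β : ℝ} (hyp : IsHyperbolic β) {x : ℝ}
    (hx : x ∈ betaSpectrum β) : ∃ S : Finset ℝ, IsBackwardClosed β S ∧ x ∈ S := by
  classical
  have hβQ : IsIntegral ℚ β := hyp.isIntegral.tower_top
  let K := IntermediateField.adjoin ℚ {β}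
  have : FiniteDimensional ℚ K := IntermediateField.adjoin.finiteDimensional hβQ
  have : NumberField K := ⟨⟩
  let b : K := IntermediateField.AdjoinSimple.gen ℚ β
  have hb : ((b : K) : ℝ) = β := IntermediateField.AdjoinSimple.coe_gen ℚ β
  have hbint : IsIntegral ℤ b := by
    have h : IsIntegral ℤ (algebraMap K ℝ b) := by
      rw [show algebraMap K ℝ b = β from hb]
      exact hyp.isIntegral
    exact (isIntegral_algebraMap_iff (algebraMap K ℝ).injective).1 h
  have hnorm : ∀ φ : K →+* ℂ, ‖φ b‖ ≠ 1 := fun φ => by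
    refine hyp.conj_ne_one _ ?_
    have h0 : aeval b (minpoly ℚ β) = 0 := by
      rw [← IntermediateField.minpoly_gen ℚ β]
      exact minpoly.aeval ℚ b
    have h1 := congrArg φ.toRatAlgHom h0
    rw [← Polynomial.aeval_algHom_apply, map_zero] at h1
    exact h1
  have lift : ∀ y ∈ betaSpectrum β, ∃ k : K, (k : ℝ) = y ∧ IsIntegral ℤ k ∧
      ∀ φ : K →+* ℂ, ‖φ b‖ < 1 → ‖φ k‖ ≤ |‖φ b‖ - 1|⁻¹ := by
    refine betaSpectrum_induction ⟨0, by simp, isIntegral_zero, fun φ _ => by simp⟩ ?_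
    rintro y ⟨k, rfl, hk, hkφ⟩ c hc
    refine ⟨b * k + c, by push_cast; rw [hb], (hbint.mul hk).add (isIntegral_algebraMap (R := ℤ) (x := c)),
      fun φ hφ => ?_⟩
    have h1 := hkφ φ hφ
    have hpos : 0 < 1 - ‖φ b‖ := by linarith
    rw [abs_of_neg (by linarith), neg_sub] at h1 ⊢
    calc ‖φ (b * k + c)‖ = ‖φ b * φ k + c‖ := by simp
      _ ≤ ‖φ b‖ * ‖φ k‖ + 1 := by
        refine (norm_add_le _ _).trans ?_
        rw [norm_mul]
        gcongr
        exact norm_intCast_le_one_of_mem hc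
      _ ≤ ‖φ b‖ * (1 - ‖φ b‖)⁻¹ + 1 := by gcongr
      _ = (1 - ‖φ b‖)⁻¹ := by field_simp; ring
  obtain ⟨kx, hkx, hkxint, -⟩ := lift x hx
  let B : ℝ := ∑ φ : K →+* ℂ, (|‖φ b‖ - 1|⁻¹ + ‖φ kx‖)
  have hB : ∀ φ : K →+* ℂ, |‖φ b‖ - 1|⁻¹ + ‖φ kx‖ ≤ B := fun φ =>
    Finset.single_le_sum (f := fun φ : K →+* ℂ => |‖φ b‖ - 1|⁻¹ + ‖φ kx‖)
      (fun _ _ => by positivity) (Finset.mem_univ φ)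
  have hB1 : ∀ φ : K →+* ℂ, |‖φ b‖ - 1|⁻¹ ≤ B := fun φ =>
    (le_add_of_nonneg_right (norm_nonneg _)).trans (hB φ)
  have hB2 : ∀ φ : K →+* ℂ, ‖φ kx‖ ≤ B := fun φ =>
    (le_add_of_nonneg_left (by positivity)).trans (hB φ)
  have hfin : ((fun k : K => (k : ℝ)) '' {k : K | IsIntegral ℤ k ∧ ∀ φ : K →+* ℂ, ‖φ k‖ ≤ B} ∩
      betaSpectrum β).Finite :=
    ((NumberField.Embeddings.finite_of_norm_le K ℂ B).image _).inter_of_left _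
  refine ⟨hfin.toFinset, ⟨?_, ?_, ?_⟩, ?_⟩
  · rw [Set.Finite.mem_toFinset]
    refine ⟨⟨0, ⟨isIntegral_zero, fun φ => ?_⟩, by simp⟩, zero_mem_betaSpectrum β⟩
    rw [map_zero, norm_zero]
    exact (norm_nonneg _).trans (hB2 φ)
  · intro y hy
    exact ((Set.Finite.mem_toFinset _).1 hy).2
  · intro y hy c hc hyc
    rw [Set.Finite.mem_toFinset] at hyc ⊢
    obtain ⟨⟨k', ⟨-, hk'⟩, hk'y⟩, -⟩ := hyc
    obtain ⟨k, rfl, hk, hkφ⟩ := lift y hy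
    refine ⟨⟨k, ⟨hk, fun φ => ?_⟩, rfl⟩, hy⟩
    rcases (hnorm φ).lt_or_gt with hφ | hφ
    · exact (hkφ φ hφ).trans (hB1 φ)
    · have hk'k : k' = b * k + c := by
        apply Subtype.ext
        push_cast
        rw [hb]
        exact hk'y
      have h1 := hk' φ
      have h2 := hB1 φ
      have hpos : 0 < ‖φ b‖ - 1 := by linarith
      rw [abs_of_pos hpos, inv_le_iff_one_le_mul₀ hpos] at h2
      have h3 : ‖φ b‖ * ‖φ k‖ ≤ B + 1 := by
        rw [← norm_mul]
        calc ‖φ b * φ k‖ = ‖φ k' - c‖ := by rw [hk'k]; simp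
          _ ≤ ‖φ k'‖ + ‖(c : ℂ)‖ := norm_sub_le _ _
          _ ≤ B + 1 := add_le_add h1 (norm_intCast_le_one_of_mem hc)
      by_contra! hlt
      have := mul_lt_mul_of_pos_left hlt (by linarith : 0 < ‖φ b‖)
      linarith
  · rw [Set.Finite.mem_toFinset]
    exact ⟨⟨kx, ⟨hkxint, hB2⟩, hkx⟩, hx⟩

/-! ### Recursion and bounds for the pair counts -/

/-- The value in base `β` of a word over `{0, 1}`. -/
noncomputable def binaryValue (β : ℝ) {n : ℕ} (a : Fin n → Fin 2) : ℝ :=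
  wordValue β fun i => ((a i : ℕ) : ℤ)

theorem pairCount_eq_sum (β : ℝ) (n : ℕ) (x : ℝ) :
    pairCount β n x = ∑ a : Fin n → Fin 2, ∑ b : Fin n → Fin 2,
      if binaryValue β a - binaryValue β b = x then 1 else 0 := by
  classical
  unfold pairCount
  rw [Nat.card_eq_fintype_card, Fintype.card_subtype, Finset.card_filter,
    Fintype.sum_prod_type]
  simp only [wordValue_sub, binaryValue]
  refine Finset.sum_congr rfl fun a _ => Finset.sum_congr rfl fun b _ => ?_
  congr

theorem sum_fin_succ_fun {M : Type*} [AddCommMonoid M] {n : ℕ} (f : (Fin (n + 1) → Fin 2) → M) :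
    ∑ a, f a = ∑ a : Fin n → Fin 2, ∑ e : Fin 2, f (Fin.snoc (α := fun _ => Fin 2) a e) := by
  rw [← (Fin.snocEquiv fun _ : Fin (n + 1) => Fin 2).sum_comp, Fintype.sum_prod_type,
    Finset.sum_comm]
  rfl

theorem binaryValue_snoc (β : ℝ) {n : ℕ} (a : Fin n → Fin 2) (e : Fin 2) :
    binaryValue β (Fin.snoc (α := fun _ => Fin 2) a e : Fin (n + 1) → Fin 2) =
      β * binaryValue β a + (e : ℕ) := by
  rw [binaryValue, wordValue_succ]
  simp [binaryValue]

theorem pairCount_zero (β x : ℝ) : pairCount β 0 x = if x = 0 then 1 else 0 := by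
  rw [pairCount_eq_sum]
  simp [binaryValue, wordValue, eq_comm]

theorem pairCount_succ {β : ℝ} (hβ : β ≠ 0) (n : ℕ) (x : ℝ) :
    pairCount β (n + 1) x = pairCount β n ((x - 1) / β) + 2 * pairCount β n (x / β) +
      pairCount β n ((x + 1) / β) := by
  simp only [pairCount_eq_sum, sum_fin_succ_fun (n := n), binaryValue_snoc, Finset.mul_sum,
    ← Finset.sum_add_distrib]
  refine Finset.sum_congr rfl fun a _ => ?_
  rw [Finset.sum_comm]
  refine Finset.sum_congr rfl fun b _ => ?_
  have e1 : β * binaryValue β a + 1 - β * binaryValue β b = x ↔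
      binaryValue β a - binaryValue β b = (x - 1) / β := by
    rw [eq_div_iff hβ]; constructor <;> intro h <;> linarith
  have e2 : β * binaryValue β a - β * binaryValue β b = x ↔
      binaryValue β a - binaryValue β b = x / β := by
    rw [eq_div_iff hβ]; constructor <;> intro h <;> linarith
  have e3 : β * binaryValue β a - (β * binaryValue β b + 1) = x ↔
      binaryValue β a - binaryValue β b = (x + 1) / β := by
    rw [eq_div_iff hβ]; constructor <;> intro h <;> linarith
  simp only [Fin.sum_univ_two, Fin.val_zero, Fin.val_one, Nat.cast_zero, Nat.cast_one, add_zero,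
    add_sub_add_right_eq_sub, e1, e2, e3]
  ring

/-- The count is the autocorrelation at lag `x` of `r`, the number of words with a given value; `2uv
≤ u² + v²` shows that lag 0 is maximal. -/
theorem pairCount_le (β : ℝ) (n : ℕ) (x : ℝ) : pairCount β n x ≤ pairCount β n 0 := by
  classical
  let V : (Fin n → Fin 2) → ℝ := binaryValue β
  let r : ℝ → ℕ := fun z => ∑ a, if V a = z then 1 else 0
  let I : Finset ℝ := Finset.univ.image V
  have hr : ∀ z, z ∉ I → r z = 0 := fun z hz => by
    refine Finset.sum_eq_zero fun a _ => if_neg fun h => hz ?_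
    exact Finset.mem_image.2 ⟨a, Finset.mem_univ _, h⟩
  have hN : ∀ t, pairCount β n t = ∑ z ∈ I, r z * r (z - t) := fun t => by
    rw [pairCount_eq_sum]
    have h1 : ∀ a : Fin n → Fin 2, (∑ b : Fin n → Fin 2,
        if binaryValue β a - binaryValue β b = t then 1 else 0) = r (V a - t) := fun a => by
      refine Finset.sum_congr rfl fun b _ => ?_
      congr 1
      apply propext
      constructor <;> intro h <;> linarith
    simp_rw [h1]
    have h2 : ∀ a, r (V a - t) = ∑ z ∈ I, (if V a = z then 1 else 0) * r (z - t) := fun a => by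
      have ha : V a ∈ I := Finset.mem_image_of_mem _ (Finset.mem_univ _)
      simp [ha]
    simp_rw [h2]
    rw [Finset.sum_comm]
    simp_rw [← Finset.sum_mul]
    rfl
  have hshift : ∑ z ∈ I, r (z - x) * r (z - x) ≤ ∑ z ∈ I, r z * r z := by
    rw [← Finset.sum_image (s := I) (g := fun z => z - x) (f := fun z => r z * r z)
      (fun a _ b _ h => by simpa using h)]
    refine Finset.sum_le_sum_of_ne_zero fun z _ hz => ?_
    by_contra h
    exact hz (by simp [hr z h])
  have hcs : 2 * ∑ z ∈ I, r z * r (z - x) ≤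
      ∑ z ∈ I, r z * r z + ∑ z ∈ I, r (z - x) * r (z - x) := by
    rw [← Finset.sum_add_distrib, Finset.mul_sum]
    refine Finset.sum_le_sum fun z _ => ?_
    have := two_mul_le_add_sq (r z) (r (z - x))
    nlinarith
  rw [hN, hN]
  simp only [sub_zero]
  omega

theorem pairCount_eq_zero_of_notMem {β x : ℝ} (hx : x ∉ betaSpectrum β) (n : ℕ) :
    pairCount β n x = 0 := by
  unfold pairCount
  rw [Nat.card_eq_zero]
  left
  refine ⟨fun p => hx ⟨n, _, fun i => ?_, p.2⟩⟩
  generalize p.1.1 i = e, p.1.2 i = e'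
  fin_cases e <;> fin_cases e' <;> simp

theorem exists_pairCount_pos {β x : ℝ} (hx : x ∈ betaSpectrum β) : ∃ n, 0 < pairCount β n x := by
  obtain ⟨n, c, hc, rfl⟩ := hx
  refine ⟨n, ?_⟩
  unfold pairCount
  rw [Nat.card_pos_iff]
  refine ⟨⟨(fun i => if c i = 1 then 1 else 0, fun i => if c i = -1 then 1 else 0), ?_⟩,
    inferInstance⟩
  congr 1
  funext i
  have := hc i
  simp only [Set.mem_insert_iff, Set.mem_singleton_iff] at this
  rcases this with h | h | h <;> simp [h]

/-! ### The transfer operator -/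

/-- The transfer operator of the maps `y ↦ β y + c`, where `c = -1, 0, 1` has weight `1, 2, 1`. -/
noncomputable def transfer (β : ℝ) : Module.End ℝ (ℝ → ℝ) where
  toFun f x := f ((x - 1) / β) + 2 * f (x / β) + f ((x + 1) / β)
  map_add' f g := by
    funext x
    simp only [Pi.add_apply]
    ring
  map_smul' a f := by
    funext x
    simp only [Pi.smul_apply, smul_eq_mul, RingHom.id_apply]
    ring

theorem transfer_apply (β : ℝ) (f : ℝ → ℝ) (x : ℝ) :
    transfer β f x = f ((x - 1) / β) + 2 * f (x / β) + f ((x + 1) / β) := rfl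

/-- `𝒩_n` as a real function. -/
noncomputable def pairWeight (β : ℝ) (n : ℕ) (x : ℝ) : ℝ := pairCount β n x

theorem transfer_pairWeight {β : ℝ} (hβ : β ≠ 0) (n : ℕ) :
    transfer β (pairWeight β n) = pairWeight β (n + 1) := by
  funext x
  rw [transfer_apply]
  simp only [pairWeight, pairCount_succ hβ]
  push_cast
  ring

theorem transfer_pow_pairWeight {β : ℝ} (hβ : β ≠ 0) (n k : ℕ) :
    (transfer β ^ k) (pairWeight β n) = pairWeight β (n + k) := by
  induction k with
  | zero => simp
  | succ k ih => rw [pow_succ', Module.End.mul_apply, ih, transfer_pairWeight hβ, add_assoc]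

theorem pairWeight_nonneg (β : ℝ) (n : ℕ) (x : ℝ) : 0 ≤ pairWeight β n x := Nat.cast_nonneg _

theorem pairWeight_eq_zero_of_notMem {β x : ℝ} (hx : x ∉ betaSpectrum β) (n : ℕ) :
    pairWeight β n x = 0 := by
  rw [pairWeight, pairCount_eq_zero_of_notMem hx, Nat.cast_zero]

theorem pairWeight_zero_apply (β x : ℝ) : pairWeight β 0 x = if x = 0 then 1 else 0 := by
  rw [pairWeight, pairCount_zero]
  split_ifs <;> simp

/-- At time 0 this is the loop of weight 2 at the origin; the positive operator carries it to later
times. -/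
theorem two_mul_pairWeight_le {β : ℝ} (hβ : β ≠ 0) (n : ℕ) (x : ℝ) :
    2 * pairWeight β n x ≤ pairWeight β (n + 1) x := by
  induction n generalizing x with
  | zero =>
    rw [← transfer_pairWeight hβ, transfer_apply, pairWeight_zero_apply β x,
      pairWeight_zero_apply β (x / β)]
    have h1 := pairWeight_nonneg β 0 ((x - 1) / β)
    have h2 := pairWeight_nonneg β 0 ((x + 1) / β)
    simp only [div_eq_zero_iff, hβ, or_false]
    linarith
  | succ n ih =>
    rw [← transfer_pairWeight hβ (n + 1), ← transfer_pairWeight hβ n, transfer_apply,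
      transfer_apply]
    have h1 := ih ((x - 1) / β)
    have h2 := ih (x / β)
    have h3 := ih ((x + 1) / β)
    rw [← transfer_pairWeight hβ n] at h1 h2 h3
    linarith

theorem pairWeight_le_add {β : ℝ} (hβ : β ≠ 0) (n k : ℕ) (x : ℝ) :
    pairWeight β n x ≤ pairWeight β (n + k) x := by
  induction k with
  | zero => rfl
  | succ k ih =>
    have h1 := two_mul_pairWeight_le hβ (n + k) x
    have h2 := pairWeight_nonneg β (n + k) x
    rw [← add_assoc]
    linarith

theorem pairWeight_zero_pos {β : ℝ} (hβ : β ≠ 0) (n : ℕ) : 0 < pairWeight β n 0 := by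
  have h := pairWeight_le_add hβ 0 n 0
  rw [zero_add, pairWeight_zero_apply, if_pos rfl] at h
  linarith

theorem pairWeight_add_le {β : ℝ} (hβ : β ≠ 0) (n k : ℕ) (x : ℝ) :
    pairWeight β (n + k) x ≤ 4 ^ k * pairWeight β n 0 := by
  induction k generalizing x with
  | zero =>
    rw [pow_zero, one_mul, add_zero]
    exact Nat.cast_le.2 (pairCount_le β n x)
  | succ k ih =>
    rw [← add_assoc, ← transfer_pairWeight hβ, transfer_apply, pow_succ]
    linarith [ih ((x - 1) / β), ih (x / β), ih ((x + 1) / β)]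

theorem exists_one_le_pairWeight {β : ℝ} (hβ : β ≠ 0) (S : Finset ℝ)
    (hS : ∀ x ∈ S, x ∈ betaSpectrum β) : ∃ k, ∀ x ∈ S, 1 ≤ pairWeight β k x := by
  choose! f hf using fun x (hx : x ∈ S) => exists_pairCount_pos (hS x hx)
  refine ⟨S.sup f, fun x hx => ?_⟩
  obtain ⟨j, hj⟩ := Nat.exists_eq_add_of_le (Finset.le_sup hx : f x ≤ S.sup f)
  rw [hj]
  exact (Nat.one_le_cast.2 (hf x hx)).trans (pairWeight_le_add hβ _ _ _)

theorem mem_betaSpectrum_of_pred {β : ℝ} (hβ : β ≠ 0) {x : ℝ} {c : ℤ}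
    (hc : c ∈ ({-1, 0, 1} : Set ℤ)) (h : (x - c) / β ∈ betaSpectrum β) : x ∈ betaSpectrum β := by
  have := mul_add_mem_betaSpectrum h hc
  rwa [mul_div_cancel₀ _ hβ, sub_add_cancel] at this

namespace IsBackwardClosed

variable {β : ℝ} {S : Finset ℝ}

theorem pred_mem_or (hS : IsBackwardClosed β S) (hβ : β ≠ 0) {x : ℝ} (hx : x ∈ S) {c : ℤ}
    (hc : c ∈ ({-1, 0, 1} : Set ℤ)) : (x - c) / β ∈ S ∨ (x - c) / β ∉ betaSpectrum β := by
  by_cases h : (x - c) / β ∈ betaSpectrum β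
  · refine Or.inl (hS.pred_mem _ h c hc ?_)
    rwa [mul_div_cancel₀ _ hβ, sub_add_cancel]
  · exact Or.inr h

/-- Signs outside `S` are irrelevant: a predecessor of a point of `S` is in `S` or off the spectrum.
-/
theorem transfer_nonneg (hS : IsBackwardClosed β S) (hβ : β ≠ 0) {f : ℝ → ℝ}
    (hf : ∀ x ∈ S, 0 ≤ f x) (hf0 : ∀ x ∉ betaSpectrum β, f x = 0) :
    (∀ x ∈ S, 0 ≤ transfer β f x) ∧ ∀ x ∉ betaSpectrum β, transfer β f x = 0 := by
  have key : ∀ x ∈ S, ∀ c ∈ ({-1, 0, 1} : Set ℤ), 0 ≤ f ((x - c) / β) := fun x hx c hc => by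
    rcases hS.pred_mem_or hβ hx hc with h | h
    · exact hf _ h
    · exact (hf0 _ h).ge
  have key0 : ∀ x ∉ betaSpectrum β, ∀ c ∈ ({-1, 0, 1} : Set ℤ), f ((x - c) / β) = 0 :=
    fun x hx c hc => hf0 _ fun h => hx (mem_betaSpectrum_of_pred hβ hc h)
  constructor
  · intro x hx
    have h1 := key x hx 1 (by simp)
    have h2 := key x hx 0 (by simp)
    have h3 := key x hx (-1) (by simp)
    push_cast at h1 h2 h3
    rw [sub_zero] at h2
    rw [sub_neg_eq_add] at h3
    rw [transfer_apply]
    positivity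
  · intro x hx
    have h1 := key0 x hx 1 (by simp)
    have h2 := key0 x hx 0 (by simp)
    have h3 := key0 x hx (-1) (by simp)
    push_cast at h1 h2 h3
    rw [sub_zero] at h2
    rw [sub_neg_eq_add] at h3
    rw [transfer_apply, h1, h2, h3]
    simp

theorem transfer_pow_nonneg (hS : IsBackwardClosed β S) (hβ : β ≠ 0) {f : ℝ → ℝ}
    (hf : ∀ x ∈ S, 0 ≤ f x) (hf0 : ∀ x ∉ betaSpectrum β, f x = 0) (k : ℕ) :
    (∀ x ∈ S, 0 ≤ (transfer β ^ k) f x) ∧ ∀ x ∉ betaSpectrum β, (transfer β ^ k) f x = 0 := by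
  induction k with
  | zero => exact ⟨hf, hf0⟩
  | succ k ih =>
    rw [pow_succ', Module.End.mul_apply]
    exact hS.transfer_nonneg hβ ih.1 ih.2

end IsBackwardClosed

/-! ### Contraction of growth ratios -/

/-- All growth ratios `𝒩_{n+1}(x) / 𝒩_n(x)`, `x ∈ S`, lie in `[m, M]`. -/
def RatioBound (β : ℝ) (S : Finset ℝ) (n : ℕ) (m M : ℝ) : Prop :=
  ∀ x ∈ S, m * pairWeight β n x ≤ pairWeight β (n + 1) x ∧
    pairWeight β (n + 1) x ≤ M * pairWeight β n x

namespace IsBackwardClosed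

variable {β : ℝ} {S : Finset ℝ} {n : ℕ} {m M : ℝ}

/-- A linear inequality between `𝒩_n`, `𝒩_{n+1}` and `𝒩_0` on `S` propagates in time. -/
theorem propagate (hS : IsBackwardClosed β S) (hβ : β ≠ 0) {a b d : ℝ} (k : ℕ)
    (h : ∀ x ∈ S, 0 ≤ a * pairWeight β n x + b * pairWeight β (n + 1) x - d * pairWeight β 0 x)
    {x : ℝ} (hx : x ∈ S) :
    0 ≤ a * pairWeight β (n + k) x + b * pairWeight β (n + k + 1) x - d * pairWeight β k x := by
  have h1 := (hS.transfer_pow_nonneg hβ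
    (f := a • pairWeight β n + b • pairWeight β (n + 1) - d • pairWeight β 0) h
    (fun y hy => by simp [pairWeight_eq_zero_of_notMem hy]) k).1 x hx
  rw [map_sub, map_add, map_smul, map_smul, map_smul, transfer_pow_pairWeight hβ,
    transfer_pow_pairWeight hβ, transfer_pow_pairWeight hβ, zero_add,
    add_right_comm] at h1
  exact h1

theorem ratioBound_add (hS : IsBackwardClosed β S) (hβ : β ≠ 0) (h : RatioBound β S n m M)
    (k : ℕ) : RatioBound β S (n + k) m M := by
  intro x hx
  have h1 := hS.propagate hβ (n := n) (a := -m) (b := 1) (d := 0) k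
    (fun y hy => by linarith [(h y hy).1]) hx
  have h2 := hS.propagate hβ (n := n) (a := M) (b := -1) (d := 0) k
    (fun y hy => by linarith [(h y hy).2]) hx
  constructor <;> linarith

/-- Slack in one of the two bounds at 0 spreads within `k` steps to all of `S`, where it is a fixed
proportion of `𝒩_{n+k}`. -/
theorem ratioBound_contract (hS : IsBackwardClosed β S) (hβ : β ≠ 0) (h : RatioBound β S n m M)
    {k : ℕ} (hk : ∀ x ∈ S, 1 ≤ pairWeight β k x) :
    ∃ m' M', M' - m' = (1 - (4 ^ k)⁻¹ / 2) * (M - m) ∧ RatioBound β S (n + k) m' M' := by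
  have ha := pairWeight_zero_pos hβ n
  have hkeep := hS.ratioBound_add hβ h k
  obtain ⟨h1, h2⟩ := h 0 hS.zero_mem
  have hmM : m ≤ M := le_of_mul_le_mul_right (h1.trans h2) ha
  set d := (M - m) / 2 with hd
  have hd0 : 0 ≤ d := by linarith
  have hmass : ∀ x ∈ S, d * (4 ^ k)⁻¹ * pairWeight β (n + k) x ≤
      d * pairWeight β n 0 * pairWeight β k x := fun x hx => by
    have h3 : (4 ^ k)⁻¹ * pairWeight β (n + k) x ≤ pairWeight β n 0 := by
      rw [inv_mul_le_iff₀ (by positivity)]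
      exact pairWeight_add_le hβ n k x
    calc d * (4 ^ k)⁻¹ * pairWeight β (n + k) x = d * ((4 ^ k)⁻¹ * pairWeight β (n + k) x) := by
          ring
      _ ≤ d * pairWeight β n 0 := by gcongr
      _ ≤ d * pairWeight β n 0 * pairWeight β k x :=
          le_mul_of_one_le_right (by positivity) (hk x hx)
  have hzero : ∀ {a b : ℝ}, (∀ y ∈ S, 0 ≤ a * pairWeight β n y + b * pairWeight β (n + 1) y) →
      d * pairWeight β n 0 ≤ a * pairWeight β n 0 + b * pairWeight β (n + 1) 0 →
      ∀ y ∈ S, 0 ≤ a * pairWeight β n y + b * pairWeight β (n + 1) y -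
        d * pairWeight β n 0 * pairWeight β 0 y := by
    intro a b hab hab0 y hy
    rw [pairWeight_zero_apply]
    split_ifs with hy0
    · subst hy0
      linarith
    · linarith [hab y hy]
  -- The ratio at 0 lies in one half of `[m, M]`; the opposite bound then has slack at least `d
  -- 𝒩_n(0)` at 0, that is, `d 𝒩_n(0) 𝒩_0` on `S`.
  rcases le_total (pairWeight β (n + 1) 0) ((m + M) / 2 * pairWeight β n 0) with hmid | hmid
  · refine ⟨m, M - d * (4 ^ k)⁻¹, by rw [hd]; ring, fun x hx => ⟨(hkeep x hx).1, ?_⟩⟩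
    have h4 := hS.propagate hβ (n := n) (a := M) (b := -1) k
      (hzero (fun y hy => by linarith [(h y hy).2]) (by rw [hd]; linarith)) hx
    linarith [hmass x hx]
  · refine ⟨m + d * (4 ^ k)⁻¹, M, by rw [hd]; ring, fun x hx => ⟨?_, (hkeep x hx).2⟩⟩
    have h4 := hS.propagate hβ (n := n) (a := -m) (b := 1) k
      (hzero (fun y hy => by linarith [(h y hy).1]) (by rw [hd]; linarith)) hx
    linarith [hmass x hx]

theorem exists_ratioBound_geometric (hS : IsBackwardClosed β S) (hβ : β ≠ 0) :
    ∃ (k : ℕ) (C r : ℝ), (∀ x ∈ S, 1 ≤ pairWeight β k x) ∧ r < 1 ∧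
      ∀ n, ∃ m M, M - m ≤ C * r ^ n ∧ RatioBound β S (n + k) m M := by
  obtain ⟨k₀, hk₀⟩ := exists_one_le_pairWeight hβ S hS.subset
  obtain ⟨k, hk, hkpos⟩ : ∃ k, (∀ x ∈ S, 1 ≤ pairWeight β k x) ∧ k ≠ 0 :=
    ⟨k₀ + 1, fun x hx => (hk₀ x hx).trans (pairWeight_le_add hβ _ _ _), by simp⟩
  have hinv : ((4 : ℝ) ^ k)⁻¹ ≤ 1 := inv_le_one_of_one_le₀ (one_le_pow₀ (by norm_num))
  have hinv0 : 0 < ((4 : ℝ) ^ k)⁻¹ := by positivity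
  set t : ℝ := 1 - (4 ^ k)⁻¹ / 2 with ht
  have ht0 : 0 < t := by linarith
  obtain ⟨r, hr0, hrt⟩ : ∃ r : ℝ, 0 < r ∧ r ^ k = t :=
    ⟨t ^ (k⁻¹ : ℝ), Real.rpow_pos_of_pos ht0 _, Real.rpow_inv_natCast_pow ht0.le hkpos⟩
  have hr1 : r < 1 := by
    by_contra! h
    have := one_le_pow₀ h (n := k)
    linarith
  have hinit : RatioBound β S k 2 (4 ^ (k + 1)) := fun x hx => by
    refine ⟨two_mul_pairWeight_le hβ k x, ?_⟩
    have h1 := pairWeight_add_le hβ 0 (k + 1) x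
    rw [pairWeight_zero_apply, if_pos rfl, mul_one, zero_add] at h1
    exact h1.trans (le_mul_of_one_le_right (by positivity) (hk x hx))
  have h42 : (2 : ℝ) ≤ 4 ^ (k + 1) := by
    have := one_le_pow₀ (by norm_num : (1 : ℝ) ≤ 4) (n := k)
    rw [pow_succ]
    linarith
  -- Since `r ^ k` is the contraction factor over `k` steps, induction goes by jumps of `k`;
  -- dividing by `r ^ k` lets the initial interval `[2, 4 ^ (k + 1)]` serve all `n < k`.
  refine ⟨k, (4 ^ (k + 1) - 2) / r ^ k, r, hk, hr1, fun n => ?_⟩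
  induction n using Nat.strong_induction_on with
  | _ n ih =>
    rcases lt_or_ge n k with hn | hn
    · refine ⟨2, 4 ^ (k + 1), ?_, ?_⟩
      · rw [div_mul_eq_mul_div, le_div_iff₀ (by positivity)]
        exact mul_le_mul_of_nonneg_left (pow_le_pow_of_le_one hr0.le hr1.le hn.le) (by linarith)
      · rw [add_comm]
        exact hS.ratioBound_add hβ hinit n
    · obtain ⟨j, rfl⟩ := Nat.exists_eq_add_of_le' hn
      obtain ⟨m, M, hmM, hb⟩ := ih j (by omega)
      obtain ⟨m', M', hmM', hb'⟩ := hS.ratioBound_contract hβ hb hk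
      refine ⟨m', M', ?_, hb'⟩
      rw [hmM', ← ht, ← hrt, pow_add]
      calc r ^ k * (M - m) ≤ r ^ k * ((4 ^ (k + 1) - 2) / r ^ k * r ^ j) := by gcongr
        _ = _ := by ring

/-- Describing `l` by the ratios at 0, a point of every `S`, makes it independent of `S`. -/
theorem exists_growth (hS : IsBackwardClosed β S) (hβ : β ≠ 0) :
    ∃ l : ℝ, 2 ≤ l ∧
      Tendsto (fun n => pairWeight β (n + 1) 0 / pairWeight β n 0) atTop (𝓝 l) ∧
      ∀ x ∈ S, ∃ g, 0 < g ∧ Tendsto (fun n => pairWeight β n x / l ^ n) atTop (𝓝 g) := by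
  obtain ⟨k, C, r, hk, hr1, hgeo⟩ := hS.exists_ratioBound_geometric hβ
  choose m M hmM hb using hgeo
  let q : ℝ → ℕ → ℝ := fun x n => pairWeight β (n + k + 1) x / pairWeight β (n + k) x
  have hpos : ∀ x ∈ S, ∀ n, 0 < pairWeight β (n + k) x := fun x hx n => by
    have h1 := pairWeight_le_add hβ k n x
    rw [add_comm k n] at h1
    linarith [hk x hx]
  have hq2 : ∀ x ∈ S, ∀ n, 2 ≤ q x n := fun x hx n =>
    (le_div_iff₀ (hpos x hx n)).2 (two_mul_pairWeight_le hβ _ x)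
  have hq : ∀ x ∈ S, ∀ n j, m n ≤ q x (n + j) ∧ q x (n + j) ≤ M n := fun x hx n j => by
    have h1 := hS.ratioBound_add hβ (hb n) j x hx
    rw [add_right_comm] at h1
    exact ⟨(le_div_iff₀ (hpos x hx _)).2 h1.1, (div_le_iff₀ (hpos x hx _)).2 h1.2⟩
  have hcauchy : CauchySeq (q 0) := by
    refine cauchySeq_of_le_geometric r C hr1 fun n => ?_
    have h1 := hq 0 hS.zero_mem n 0
    rw [add_zero] at h1
    have h2 := hq 0 hS.zero_mem n 1
    rw [Real.dist_eq, abs_le]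
    constructor <;> linarith [hmM n, h1.1, h1.2, h2.1, h2.2]
  obtain ⟨l, hl⟩ := cauchySeq_tendsto_of_complete hcauchy
  have hl2 : 2 ≤ l := ge_of_tendsto' hl (hq2 0 hS.zero_mem)
  have hl0 : 0 < l := by linarith
  have hlmem : ∀ n, m n ≤ l ∧ l ≤ M n := fun n => by
    have h1 : Tendsto (fun j => q 0 (n + j)) atTop (𝓝 l) := by
      simp_rw [add_comm n]
      exact (tendsto_add_atTop_iff_nat n).2 hl
    exact ⟨ge_of_tendsto' h1 fun j => (hq 0 hS.zero_mem n j).1,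
      le_of_tendsto' h1 fun j => (hq 0 hS.zero_mem n j).2⟩
  refine ⟨l, hl2, (tendsto_add_atTop_iff_nat k).1 hl, fun x hx => ?_⟩
  -- The logarithm is 1-Lipschitz on `[2, ∞)`, so geometric errors in the ratios become geometric
  -- increments of `L`.
  have hlog : ∀ {a b : ℝ}, 2 ≤ a → 2 ≤ b → Real.log a - Real.log b ≤ |a - b| := by
    intro a b ha hb
    rw [← Real.log_div (by positivity) (by positivity)]
    refine (Real.log_le_sub_one_of_pos (by positivity)).trans ?_
    rw [div_sub_one (by positivity), div_le_iff₀ (by positivity)]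
    nlinarith [le_abs_self (a - b), abs_nonneg (a - b)]
  let L : ℕ → ℝ := fun n => Real.log (pairWeight β (n + k) x) - n * Real.log l
  have hLcauchy : CauchySeq L := by
    refine cauchySeq_of_le_geometric r C hr1 fun n => ?_
    have h1 := hq x hx n 0
    rw [add_zero] at h1
    have h2 := hlmem n
    have hql : |q x n - l| ≤ C * r ^ n := by
      rw [abs_le]
      constructor <;> linarith [hmM n, h1.1, h1.2]
    have hqn : Real.log (q x n) =
        Real.log (pairWeight β (n + 1 + k) x) - Real.log (pairWeight β (n + k) x) := by
      rw [add_right_comm n 1 k]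
      exact Real.log_div (by rw [add_right_comm]; exact (hpos x hx _).ne') (hpos x hx _).ne'
    have hdiff : L (n + 1) - L n = Real.log (q x n) - Real.log l := by
      simp only [L, hqn]
      push_cast
      ring
    rw [dist_comm, Real.dist_eq, hdiff, abs_le]
    have h3 := hlog (hq2 x hx n) hl2
    have h4 := hlog hl2 (hq2 x hx n)
    rw [abs_sub_comm] at h4
    constructor <;> linarith
  obtain ⟨a, ha⟩ := cauchySeq_tendsto_of_complete hLcauchy
  refine ⟨Real.exp a / l ^ k, by positivity, (tendsto_add_atTop_iff_nat k).1 ?_⟩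
  refine (((Real.continuous_exp.tendsto a).comp ha).div_const (l ^ k)).congr fun n => ?_
  simp only [Function.comp, L]
  rw [Real.exp_sub, Real.exp_log (hpos x hx n), Real.exp_nat_mul, Real.exp_log hl0, pow_add,
    div_div]

end IsBackwardClosed

/-! ### The eigenfunction and its mass -/

theorem exists_eigenfunction {β : ℝ} (hβ : β ≠ 0) (hyp : IsHyperbolic β) :
    ∃ (l : ℝ) (g : ℝ → ℝ), 2 ≤ l ∧ (∀ x ∈ betaSpectrum β, 0 < g x) ∧
      (∀ x ∉ betaSpectrum β, g x = 0) ∧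
      (∀ x, Tendsto (fun n => pairWeight β n x / l ^ n) atTop (𝓝 (g x))) ∧
      ∀ x, l * g x = transfer β g x := by
  obtain ⟨S₀, hS₀, -⟩ := exists_isBackwardClosed hyp (zero_mem_betaSpectrum β)
  obtain ⟨l, hl2, hl, -⟩ := hS₀.exists_growth hβ
  have hl0 : l ≠ 0 := by positivity
  have hex : ∀ x, ∃ a, (x ∈ betaSpectrum β → 0 < a) ∧ (x ∉ betaSpectrum β → a = 0) ∧
      Tendsto (fun n => pairWeight β n x / l ^ n) atTop (𝓝 a) := fun x => by
    by_cases hx : x ∈ betaSpectrum β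
    · obtain ⟨S, hS, hxS⟩ := exists_isBackwardClosed hyp hx
      obtain ⟨l', -, hl', hlim⟩ := hS.exists_growth hβ
      obtain ⟨a, ha, hta⟩ := hlim x hxS
      rw [tendsto_nhds_unique hl' hl] at hta
      exact ⟨a, fun _ => ha, fun h => absurd hx h, hta⟩
    · refine ⟨0, fun h => absurd h hx, fun _ => rfl, ?_⟩
      simp [pairWeight_eq_zero_of_notMem hx]
  choose g hg1 hg2 hg3 using hex
  refine ⟨l, g, hl2, hg1, hg2, hg3, fun x => ?_⟩
  refine tendsto_nhds_unique
    (((tendsto_add_atTop_iff_nat 1).2 (hg3 x)).const_mul l)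
    ((((hg3 ((x - 1) / β)).add ((hg3 (x / β)).const_mul 2)).add (hg3 ((x + 1) / β))).congr
      fun n => ?_)
  rw [← transfer_pairWeight hβ n, transfer_apply, pow_succ]
  field_simp

theorem IsBackwardClosed.eigenvalue_lt_four {β : ℝ} {S : Finset ℝ} (hS : IsBackwardClosed β S)
    (hβ : 1 < β) {l : ℝ} {g : ℝ → ℝ} (hpos : ∀ x ∈ betaSpectrum β, 0 < g x)
    (hzero : ∀ x ∉ betaSpectrum β, g x = 0) (heig : ∀ x, l * g x = transfer β g x) : l < 4 := by
  classical
  have hβ0 : β ≠ 0 := by positivity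
  have hnn : ∀ x, 0 ≤ g x := fun x => by
    by_cases hx : x ∈ betaSpectrum β
    · exact (hpos x hx).le
    · exact (hzero x hx).ge
  have hsum : ∀ U : Finset ℝ, ∀ c : ℝ,
      (∀ x ∈ S, (x - c) / β ∈ U ∨ (x - c) / β ∉ betaSpectrum β) →
      ∑ x ∈ S, g ((x - c) / β) ≤ ∑ y ∈ U, g y := by
    intro U c hU
    have hinj : Set.InjOn (fun x : ℝ => (x - c) / β) S := fun a _ b _ h => by
      have := (div_left_inj' hβ0).1 h
      linarith
    rw [← Finset.sum_image (f := g) hinj,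
      ← Finset.sum_filter_of_ne (p := fun y => y ∈ U)]
    · exact Finset.sum_le_sum_of_subset_of_nonneg
        (fun y hy => (Finset.mem_filter.1 hy).2) fun y _ _ => hnn y
    · intro y hy hgy
      obtain ⟨x, hx, rfl⟩ := Finset.mem_image.1 hy
      exact (hU x hx).resolve_right fun h => hgy (hzero _ h)
  have hne : S.Nonempty := ⟨0, hS.zero_mem⟩
  have hmax0 : 0 ≤ S.max' hne := S.le_max' _ hS.zero_mem
  -- The maximum of `S` is nonnegative, so its successor `β * max + 1` exceeds it and lies outside
  -- `S`; its mass is therefore missing from this sum.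
  have h1 := hsum (S.erase (S.max' hne)) 1 fun x hx => by
    have := hS.pred_mem_or hβ0 hx (c := 1) (by simp)
    rw [Int.cast_one] at this
    refine this.imp_left fun h => Finset.mem_erase.2 ⟨fun heq => ?_, h⟩
    rw [div_eq_iff hβ0] at heq
    have hle := S.le_max' x hx
    nlinarith
  have h2 := hsum S 0 fun x hx => by
    simpa using hS.pred_mem_or hβ0 hx (c := 0) (by simp)
  have h3 := hsum S (-1) fun x hx => by
    simpa using hS.pred_mem_or hβ0 hx (c := -1) (by simp)
  have herase := Finset.sum_erase_add S g (S.max'_mem hne)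
  have hmaxpos := hpos _ (hS.subset _ (S.max'_mem hne))
  have hS0 : 0 < ∑ y ∈ S, g y := Finset.sum_pos (fun y hy => hpos y (hS.subset y hy)) hne
  have htotal : l * ∑ y ∈ S, g y = ∑ x ∈ S, g ((x - 1) / β) +
      2 * ∑ x ∈ S, g ((x - 0) / β) + ∑ x ∈ S, g ((x - -1) / β) := by
    simp_rw [Finset.mul_sum, ← Finset.sum_add_distrib]
    refine Finset.sum_congr rfl fun x _ => ?_
    rw [heig, transfer_apply, sub_zero, sub_neg_eq_add]
  by_contra! hl
  nlinarith

/-- The three affine maps are bijections of `ℝ` with weights adding up to 4; a finite nonzero total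
would force `l = 4`. -/
theorem tsum_eigenfunction_eq_top {β : ℝ} (hβ : β ≠ 0) {l : ℝ} (hl : l < 4) {g : ℝ → ℝ}
    (hnn : ∀ x, 0 ≤ g x) {x₀ : ℝ} (hx₀ : 0 < g x₀) (heig : ∀ x, l * g x = transfer β g x) :
    ∑' x, ENNReal.ofReal (g x) = ⊤ := by
  have hshift : ∀ c : ℝ, ∑' x, ENNReal.ofReal (g ((x - c) / β)) = ∑' x, ENNReal.ofReal (g x) :=
    fun c => ((Equiv.subRight c).trans (Equiv.divRight₀ β hβ)).tsum_eq
      fun x => ENNReal.ofReal (g x)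
  have htotal : ENNReal.ofReal l * ∑' x, ENNReal.ofReal (g x) =
      4 * ∑' x, ENNReal.ofReal (g x) := by
    rw [← ENNReal.tsum_mul_left]
    calc ∑' x, ENNReal.ofReal l * ENNReal.ofReal (g x)
        = ∑' x, (ENNReal.ofReal (g ((x - 1) / β)) + 2 * ENNReal.ofReal (g ((x - 0) / β)) +
            ENNReal.ofReal (g ((x - -1) / β))) := by
          refine tsum_congr fun x => ?_
          rw [← ENNReal.ofReal_mul' (hnn x), heig, transfer_apply, sub_zero, sub_neg_eq_add,
            ENNReal.ofReal_add (add_nonneg (hnn _) (mul_nonneg zero_le_two (hnn _))) (hnn _),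
            ENNReal.ofReal_add (hnn _) (mul_nonneg zero_le_two (hnn _)),
            ENNReal.ofReal_mul zero_le_two, ENNReal.ofReal_ofNat]
      _ = 4 * ∑' x, ENNReal.ofReal (g x) := by
          rw [ENNReal.tsum_add, ENNReal.tsum_add, ENNReal.tsum_mul_left, hshift, hshift, hshift]
          ring
  by_contra htop
  have hne : ∑' x, ENNReal.ofReal (g x) ≠ 0 := fun h =>
    hx₀.not_ge (ENNReal.ofReal_eq_zero.1 (ENNReal.tsum_eq_zero.1 h x₀))
  have h4 := (ENNReal.mul_left_inj hne htop).1 htotal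
  have : ENNReal.ofReal l < 4 := by
    rw [← ENNReal.ofReal_ofNat 4]
    exact (ENNReal.ofReal_lt_ofReal_iff (by norm_num)).2 hl
  exact this.ne h4

theorem theorem1 (β : ℝ) (hβ : 1 < β) (hyp : IsHyperbolic β) :
    ∃ l : ℝ, 1 < l ∧ l < 4 ∧ ∃ μ : Measure ℝ,
      (∀ x ∈ betaSpectrum β,
        0 < μ {x} ∧ μ {x} < ⊤ ∧
          Tendsto (fun n : ℕ => (pairCount β n x : ℝ) / l ^ n) atTop (𝓝 (μ {x}).toReal)) ∧
      μ (betaSpectrum β)ᶜ = 0 ∧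
      μ Set.univ = ⊤ := by
  have hβ0 : β ≠ 0 := by positivity
  obtain ⟨l, g, hl2, hpos, hzero, hlim, heig⟩ := exists_eigenfunction hβ0 hyp
  have hnn : ∀ x, 0 ≤ g x := fun x => by
    by_cases hx : x ∈ betaSpectrum β
    · exact (hpos x hx).le
    · exact (hzero x hx).ge
  obtain ⟨S, hS, -⟩ := exists_isBackwardClosed hyp (zero_mem_betaSpectrum β)
  have hl4 := hS.eigenvalue_lt_four hβ hpos hzero heig
  let μ : Measure ℝ := Measure.sum fun y => ENNReal.ofReal (g y) • Measure.dirac y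
  have hμ : ∀ A : Set ℝ, MeasurableSet A →
      μ A = ∑' y, ENNReal.ofReal (g y) * A.indicator 1 y := fun A hA => by
    simp only [μ, Measure.sum_apply _ hA, Measure.smul_apply, Measure.dirac_apply' _ hA,
      smul_eq_mul]
  have hμx : ∀ x, μ {x} = ENNReal.ofReal (g x) := fun x => by
    rw [hμ _ (measurableSet_singleton x), tsum_eq_single x]
    · simp
    · intro y hy
      simp [hy]
  refine ⟨l, by linarith, hl4, μ, fun x hx => ?_, ?_, ?_⟩
  · rw [hμx, ENNReal.toReal_ofReal (hnn x)]
    exact ⟨ENNReal.ofReal_pos.2 (hpos x hx), ENNReal.ofReal_lt_top, hlim x⟩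
  · rw [hμ _ (countable_betaSpectrum β).measurableSet.compl, ENNReal.tsum_eq_zero]
    intro y
    by_cases hy : y ∈ betaSpectrum β
    · simp [hy]
    · simp [hzero y hy]
  · rw [hμ _ MeasurableSet.univ]
    simpa using tsum_eigenfunction_eq_top hβ0 hl4 hnn (hpos 0 (zero_mem_betaSpectrum β)) heig
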